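/- Let $m\ge 1$, $0<\Lambda<\infty$, and let $b_0,\dots,b_{2m}$ be real numbers. Put $\Gamma_k=(b_{i+j})_{i,j=0}^{k}$, $\Gamma^{(1)}_k=(b_{i+j+1})_{i,j=0}^{k}$, $\Delta_k=\det\Gamma_k$, $\Delta^1_k=\det\Gamma^{(1)}_k$, $\Delta_{-1}=\Delta^1_{-1}=1$. Assume: (a) $\Gamma_m\ge 0$; (b) for all $0\le r\le m-1$ and $\xi_0,\dots,\xi_r\in\mathbb C$: if $\sum_{j,k=0}^r b_{j+k}\xi_k\overline{\xi_j}=0$, then $\sum_{j,k=0}^r b_{j+k+2}\xi_k\overline{\xi_j}=0$; (c) $\Gamma^{(1)}_{m-1}\ge 0$, and for all $0\le r\le m-1$ and $\xi_0,\dots,\xi_r\in\mathbb C$: if $\sum_{j,k=0}^r b_{j+k+1}\xi_k\overline{\xi_j}=0$, then $\sum_{j,k=0}^r b_{j+k+2}\xi_k\overline{\xi_j}=0$. A solution of the truncated Hausdorff problem on $[0,\Lambda]$ is a finite non-negative Borel measure $\sigma$ concentrated on $[0,\Lambda]$ with $\int_0^\Lambda t^k\,d\sigma(t)=b_k$ for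 $k=0,\dots,2m$. If $\Delta_m>0$, let $$d_k(t)=\frac{1}{\sqrt{\Delta_k\Delta_{k-1}}}\det\begin{pmatrix} b_0&b_1&\cdots&b_k\\ \vdots&\vdots&&\vdots\\ b_{k-1}&b_k&\cdots&b_{2k-1}\\ 1&t&\cdots&t^k\end{pmatrix}\qquad(0\le k\le m)$$ be the orthonormal polynomials of $(b_k)$ (so $d_0=1/\sqrt{b_0}$), let $d^1_k$ ($0\le k\le m-1$) be those of the shifted sequence $(b_{k+1})$, and put $$R(\lambda)=\sqrt{\frac{\Delta_m\,\Delta^1_{m-2}}{\Delta_{m-1}\,\Delta^1_{m-1}}}\;\frac{d^1_{m-1}(\lambda)}{d_m(\lambda)}.$$ Case $\Delta_m>0$: the truncated Hausdorff problem on $[0,\Lambda]$ has a solution if and only if $\Lambda\Gamma_{m-1}-\Gamma^{(1)}_{m-1}\ge 0$ and, for every real $\lambda\ge\Lambda$, $d_m(\lambda)\ne0$ and $R(\lambda)\le 1$. If it has a solution, then the solution is unique if and only if $R(\Lambda)=1$. Case $\Delta_m=0$ (where $d_m$ is not defined and the conditions on $R$ are void): the problem has a solution if and only if $\Lambda\Gamma_{m-1}-\Gamma^{(1)}_{m-1}\ge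 0$, and then the solution is unique. -/

import Mathlib

open MeasureTheory

noncomputable section

namespace TruncatedHausdorff

/-- The `n × n` Hankel matrix `(b_{j+k})_{j,k=0}^{n-1}`. Matrices are indexed by their size, so the
matrix with entries `b_0, …, b_{2m}` is `hankel b (m + 1)`. -/
def hankel (b : ℕ → ℝ) (n : ℕ) : Matrix (Fin n) (Fin n) ℝ :=
  Matrix.of fun j k => b ((j : ℕ) + (k : ℕ))

/-- The determinant of the `n × n` Hankel matrix; it is `1` for `n = 0`. In the usual notation
`Δ_k = det (b_{p+q})_{p,q=0}^{k}` is `hankelDet b (k + 1)`, and `Δ_{-1} = 1`. -/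
def hankelDet (b : ℕ → ℝ) (n : ℕ) : ℝ :=
  (hankel b n).det

/-- The shifted sequence `b^1_k = b_{k+1}`. -/
def shift (b : ℕ → ℝ) : ℕ → ℝ :=
  fun k => b (k + 1)

/-- The value at `t` of the `k`-th orthonormal polynomial `d_k` of the moment sequence `b`,
`d_k(t) = (Δ_k Δ_{k-1})^{-1/2} det M`, where the first `k` rows of the `(k+1) × (k+1)` matrix `M`
are the rows of the Hankel matrix and the last row is `1, t, …, t^k`. -/
def orthPoly (b : ℕ → ℝ) (k : ℕ) (t : ℝ) : ℝ :=
  1 / √(hankelDet b (k + 1) * hankelDet b k) *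
    (Matrix.of fun i j : Fin (k + 1) =>
      if i = Fin.last k then t ^ (j : ℕ) else b ((i : ℕ) + (j : ℕ))).det

/-- The Hermitian form `∑_{j,k=0}^{r} c_{j+k} ξ_k conj(ξ_j)`. -/
def hankelForm (c : ℕ → ℝ) (r : ℕ) (ξ : ℕ → ℂ) : ℂ :=
  ∑ j ∈ Finset.range (r + 1), ∑ k ∈ Finset.range (r + 1),
    (c (j + k) : ℂ) * ξ k * (starRingEnd ℂ) (ξ j)

/-- `μ` solves the truncated Hausdorff problem on `[0, Λ]` for `b_0, …, b_{2m}`: it is a finite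
non-negative measure concentrated on `[0, Λ]` with these power moments. -/
def IsSolution (b : ℕ → ℝ) (m : ℕ) (Λ : ℝ) (μ : Measure ℝ) : Prop :=
  IsFiniteMeasure μ ∧ μ (Set.Icc 0 Λ)ᶜ = 0 ∧ ∀ k ≤ 2 * m, ∫ t, t ^ k ∂μ = b k

/-- The quantity `√(Δ_m Δ^1_{m-2} / (Δ_{m-1} Δ^1_{m-1})) · d^1_{m-1}(x) / d_m(x)`, for `m ≥ 1`. -/
def ratio (b : ℕ → ℝ) (m : ℕ) (x : ℝ) : ℝ :=
  √(hankelDet b (m + 1) * hankelDet (shift b) (m - 1) /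
      (hankelDet b m * hankelDet (shift b) m)) *
    (orthPoly (shift b) (m - 1) x / orthPoly b m x)

end TruncatedHausdorff

end

/-! Let `L` be the functional on polynomials with moments `b_k`. If `Δ_m > 0`, then `L` is definite
up to degree `m`, and by (c) so is `f ↦ L (X f)` below degree `m`. Let `P` and `Q` be their monic
orthogonal polynomials of degree `m`. A determinant computation gives `R = 1 - Q / P`
(`exists_orthogonal_pair`), so the conditions on `R` say that `P > 0` and `Q ≥ 0` on `[Λ, ∞)`.

The roots of `Q` are the free nodes of the Gauss–Radau quadrature with fixed node `0`
(`exists_radau`). They are simple and positive, so `Q ≥ 0` beyond `Λ` puts all nodes in `[0, Λ]`,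
and the quadrature is a solution. Conversely, if there is a solution and `Q = (X - x) q` with `x >
Λ`, then `t (x - t) q²` has integral `0`, so `t q` vanishes almost everywhere, against definiteness.
The weight `x - t` does the same for `P`, even at `x = Λ`.

`R(Λ) = 1` means `Q(Λ) = 0`. Then `t (Λ - t) q²` is non-negative on `[0, Λ]` and null for `L`, which
confines every solution to the same few points, where the moments fix the masses. If `Q(Λ) ≠ 0`, the
Radau quadrature with fixed node `Λ` is a second solution, without mass at `0`.

If `Δ_m = 0`, take a monic null polynomial of least degree. By (b) it is orthogonal to so many
powers that its roots carry a quadrature exact to degree `2m`. The semidefiniteness conditions place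
the roots in `[0, Λ]`, and the null square gives uniqueness. -/

noncomputable section

namespace TruncatedHausdorff

/-! ### Moment functionals, orthogonal polynomials and quadrature. -/

section

open Polynomial

/-- The linear functional on real polynomials that sends `X ^ k` to `b k`. -/
def momentFunctional (b : ℕ → ℝ) : ℝ[X] →ₗ[ℝ] ℝ :=
  lsum fun i => b i • LinearMap.id

@[simp]
theorem momentFunctional_X_pow (b : ℕ → ℝ) (k : ℕ) : momentFunctional b (X ^ k) = b k := by
  simp [momentFunctional, lsum, ← monomial_one_right_eq_X_pow, sum_monomial_index]

theorem momentFunctional_C_mul (b : ℕ → ℝ) (a : ℝ) (p : ℝ[X]) :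
    momentFunctional b (C a * p) = a * momentFunctional b p := by
  rw [← smul_eq_C_mul, map_smul, smul_eq_mul]

theorem momentFunctional_eq_sum (b : ℕ → ℝ) {n : ℕ} {p : ℝ[X]} (hp : p.natDegree < n) :
    momentFunctional b p = ∑ i ∈ Finset.range n, p.coeff i * b i := by
  conv_lhs => rw [p.as_sum_range_C_mul_X_pow' hp]
  simp [map_sum, momentFunctional_C_mul]

theorem momentFunctional_shift (b : ℕ → ℝ) (p : ℝ[X]) :
    momentFunctional (shift b) p = momentFunctional b (X * p) := by
  have h : momentFunctional (shift b) = momentFunctional b ∘ₗ LinearMap.mulLeft ℝ X := by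
    refine lhom_ext' fun n => LinearMap.ext_ring ?_
    simp [monomial_one_right_eq_X_pow, ← pow_succ', shift]
  simp [h]

/-- The functional of the sequence `Λ b_k - b_{k+1}` is the original one weighted by `Λ - t`. -/
theorem momentFunctional_sub_shift (b : ℕ → ℝ) (Λ : ℝ) (p : ℝ[X]) :
    momentFunctional (fun i => Λ * b i - b (i + 1)) p = momentFunctional b ((C Λ - X) * p) := by
  have h : momentFunctional (fun i => Λ * b i - b (i + 1)) =
      momentFunctional b ∘ₗ LinearMap.mulLeft ℝ (C Λ - X) := by
    refine lhom_ext' fun n => LinearMap.ext_ring ?_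
    simp [monomial_one_right_eq_X_pow, sub_mul, ← pow_succ', momentFunctional_C_mul]
  simp [h]

/-- The functional `M` is positive definite on polynomials of degree less than `n`. -/
def PosOn (M : ℝ[X] →ₗ[ℝ] ℝ) (n : ℕ) : Prop :=
  ∀ q : ℝ[X], q ≠ 0 → q.natDegree < n → 0 < M (q * q)

/-- `p` is orthogonal with respect to `M` to all polynomials of degree less than `n`. -/
def OrthTo (M : ℝ[X] →ₗ[ℝ] ℝ) (p : ℝ[X]) (n : ℕ) : Prop :=
  ∀ q : ℝ[X], q.natDegree < n → M (p * q) = 0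

theorem OrthTo.of_X_pow {M : ℝ[X] →ₗ[ℝ] ℝ} {p : ℝ[X]} {n : ℕ}
    (h : ∀ i < n, M (p * X ^ i) = 0) : OrthTo M p n := by
  intro q hq
  rw [q.as_sum_range_C_mul_X_pow' hq, Finset.mul_sum, map_sum]
  refine Finset.sum_eq_zero fun i hi => ?_
  rw [mul_left_comm, ← smul_eq_C_mul, map_smul, h i (Finset.mem_range.1 hi), smul_zero]

/-- An orthogonal polynomial has no factor `(X - a)² + c²`. -/
theorem OrthTo.not_quadratic_dvd {M : ℝ[X] →ₗ[ℝ] ℝ} {p : ℝ[X]} {n : ℕ} (hM : PosOn M n)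
    (hp : p.Monic) (hn : p.natDegree = n) (ho : OrthTo M p n) (a c : ℝ) :
    ¬ ((X - C a) ^ 2 + C (c ^ 2)) ∣ p := by
  rintro ⟨g, hg⟩
  have hg0 : g ≠ 0 := by
    rintro rfl
    exact hp.ne_zero (by simpa using hg)
  have hmon : ((X - C a) ^ 2 + C (c ^ 2)).Monic := by monicity!
  have hd2 : ((X - C a) ^ 2 + C (c ^ 2)).natDegree = 2 := by compute_degree!
  have hd : n = 2 + g.natDegree := by
    rw [← hn, hg, hmon.natDegree_mul' hg0, hd2]
  have h1 : 0 < M (((X - C a) * g) * ((X - C a) * g)) := by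
    apply hM _ (mul_ne_zero (X_sub_C_ne_zero a) hg0)
    rw [(monic_X_sub_C a).natDegree_mul' hg0, natDegree_X_sub_C]
    omega
  have h2 : 0 < M (g * g) := hM _ hg0 (by omega)
  have h3 := ho g (by omega)
  -- Orthogonality kills `M (p g)`, yet this writes it as a positive term plus a non-negative one.
  have h4 : p * g = ((X - C a) * g) * ((X - C a) * g) + (c ^ 2) • (g * g) := by
    rw [hg, smul_eq_C_mul]
    ring
  rw [h4, map_add, map_smul, smul_eq_mul] at h3
  have : 0 ≤ c ^ 2 * M (g * g) := by positivity
  linarith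

/-- An orthogonal polynomial has simple real roots. -/
theorem OrthTo.exists_nodal {M : ℝ[X] →ₗ[ℝ] ℝ} {p : ℝ[X]} {n : ℕ} (hM : PosOn M n)
    (hp : p.Monic) (hn : p.natDegree = n) (ho : OrthTo M p n) :
    ∃ S : Finset ℝ, p = Lagrange.nodal S id ∧ S.card = n := by
  classical
  have hsplit : p.Splits := by
    rw [splits_iff_splits]
    refine Or.inr fun {g} hgi hgp => ?_
    obtain ⟨z, hz⟩ := IsAlgClosed.exists_aeval_eq_zero ℂ g
      (by rw [degree_eq_natDegree hgi.ne_zero]; exact_mod_cast hgi.natDegree_pos.ne')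
    by_cases him : z.im = 0
    · have hz' : z = ((z.re : ℝ) : ℂ) := by
        apply Complex.ext <;> simp [him]
      refine degree_eq_one_of_irreducible_of_root hgi (x := z.re) ?_
      rw [hz'] at hz
      have := (aeval_algebraMap_apply ℂ z.re g).symm.trans hz
      simpa using this
    · exfalso
      have h1 := g.quadratic_dvd_of_aeval_eq_zero_im_ne_zero hz him
      refine ho.not_quadratic_dvd hM hp hn z.re z.im (dvd_trans ?_ hgp)
      convert h1 using 1
      rw [Complex.sq_norm, Complex.normSq_apply]
      simp only [map_add, map_mul, map_pow, map_ofNat]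
      ring
  -- A double root is the excluded factor with `c = 0`.
  have hnodup : p.roots.Nodup := by
    rw [Multiset.nodup_iff_count_le_one]
    intro a
    by_contra! h
    rw [count_roots] at h
    have := (le_rootMultiplicity_iff hp.ne_zero (n := 2)).1 h
    exact ho.not_quadratic_dvd hM hp hn a 0 (by simpa using this)
  refine ⟨p.roots.toFinset, ?_, ?_⟩
  · conv_lhs => rw [hsplit.eq_prod_roots_of_monic hp]
    rw [Lagrange.nodal_eq, Finset.prod, Multiset.toFinset_val, hnodup.dedup]
    rfl
  · rw [Multiset.toFinset_card_of_nodup hnodup, ← hsplit.natDegree_eq_card_roots, hn]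

/-- Interpolatory quadrature: if `M` annihilates the multiples of degree at most `d` of the nodal
polynomial, it is a combination of evaluations at the nodes up to degree `d`. -/
theorem eq_sum_eval_of_nodal {M : ℝ[X] →ₗ[ℝ] ℝ} {S : Finset ℝ} {d : ℕ}
    (h : ∀ q : ℝ[X], q.natDegree + S.card ≤ d → M (Lagrange.nodal S id * q) = 0)
    {f : ℝ[X]} (hf : f.natDegree ≤ d) :
    M f = ∑ t ∈ S, M (Lagrange.basis S id t) * f.eval t := by
  have hmon : (Lagrange.nodal S (id : ℝ → ℝ)).Monic := Lagrange.nodal_monic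
  have hN := modByMonic_add_div f (Lagrange.nodal S (id : ℝ → ℝ))
  have h0 : M (Lagrange.nodal S id * (f /ₘ Lagrange.nodal S id)) = 0 := by
    -- For `f` of degree below `S.card` the quotient is `0`, but `h` need not cover it, since
    -- `S.card` may exceed `d`.
    by_cases hlt : f.natDegree < S.card
    · rw [(divByMonic_eq_zero_iff hmon).2, mul_zero, map_zero]
      rw [Lagrange.degree_nodal]
      exact degree_le_natDegree.trans_lt (by exact_mod_cast hlt)
    · apply h
      rw [natDegree_divByMonic _ hmon, Lagrange.natDegree_nodal]
      omega
  have h1 : f %ₘ Lagrange.nodal S id =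
      Lagrange.interpolate S id fun t => f.eval t := by
    refine Lagrange.eq_interpolate_of_eval_eq _ (Set.injOn_id _) ?_ fun t ht => ?_
    · rw [← Lagrange.degree_nodal (s := S) (v := (id : ℝ → ℝ))]
      exact degree_modByMonic_lt _ hmon
    · conv_rhs => rw [← hN]
      simp only [eval_add, eval_mul, id]
      rw [show eval t (Lagrange.nodal S id) = 0 from Lagrange.eval_nodal_at_node (v := id) ht]
      simp
  rw [← congrArg M hN, map_add, h0, add_zero, h1, Lagrange.interpolate_apply, map_sum]
  refine Finset.sum_congr rfl fun t _ => ?_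
  rw [← smul_eq_C_mul, map_smul, smul_eq_mul, mul_comm]

theorem nodal_eq_sub_mul_erase {S : Finset ℝ} {t : ℝ} (ht : t ∈ S) :
    Lagrange.nodal S id = (X - C t) * Lagrange.nodal (S.erase t) id :=
  Lagrange.nodal_eq_mul_nodal_erase (v := id) ht

theorem eval_nodal_ne_zero {S : Finset ℝ} {t : ℝ} (ht : t ∉ S) :
    (Lagrange.nodal S id).eval t ≠ 0 :=
  Lagrange.eval_nodal_not_at_node fun i hi h => ht (by rw [h]; exact hi)

theorem eval_nodal_eq_zero {S : Finset ℝ} {t : ℝ} (ht : t ∈ S) :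
    (Lagrange.nodal S id).eval t = 0 :=
  Lagrange.eval_nodal_at_node (v := id) ht

/-- Gauss–Radau quadrature with prescribed node `c`: the free nodes are the roots of the
orthogonal polynomial for the weight `σ (t - c)`; they lie on the positive side of the weight, and
all the quadrature weights are positive. -/
theorem exists_radau {L : ℝ[X] →ₗ[ℝ] ℝ} {m : ℕ} (hm : 1 ≤ m) {c σ : ℝ} (hσ : σ ≠ 0)
    (hL : PosOn L (m + 1)) {S : Finset ℝ} (hS : S.card = m)
    (hW : PosOn (L ∘ₗ LinearMap.mulLeft ℝ (C σ * (X - C c))) m)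
    (ho : OrthTo (L ∘ₗ LinearMap.mulLeft ℝ (C σ * (X - C c))) (Lagrange.nodal S id) m) :
    c ∉ S ∧ (∀ t ∈ S, 0 < σ * (t - c)) ∧ ∃ w : ℝ → ℝ, (∀ t ∈ insert c S, 0 < w t) ∧
      ∀ f : ℝ[X], f.natDegree ≤ 2 * m → L f = ∑ t ∈ insert c S, w t * f.eval t := by
  have hscal : ∀ (a : ℝ) (p : ℝ[X]), L (C a * p) = a * L p := fun a p => by
    rw [← smul_eq_C_mul, map_smul, smul_eq_mul]
  have hW' : ∀ q : ℝ[X], q ≠ 0 → q.natDegree < m → 0 < σ * L ((X - C c) * (q * q)) := by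
    intro q hq hqd
    have := hW q hq hqd
    rwa [LinearMap.comp_apply, LinearMap.mulLeft_apply, mul_assoc, hscal] at this
  have ho' : ∀ q : ℝ[X], q.natDegree < m →
      L ((X - C c) * (Lagrange.nodal S id * q)) = 0 := by
    intro q hqd
    have := ho q hqd
    rw [LinearMap.comp_apply, LinearMap.mulLeft_apply, mul_assoc, hscal] at this
    exact (mul_eq_zero.1 this).resolve_left hσ
  have hdeg : ∀ {t : ℝ}, t ∈ S → (Lagrange.nodal (S.erase t) (id : ℝ → ℝ)).natDegree = m - 1 := by
    intro t ht
    rw [Lagrange.natDegree_nodal, Finset.card_erase_of_mem ht, hS]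
  have hpos : ∀ t ∈ S, 0 < σ * (t - c) := by
    intro t ht
    set q := Lagrange.nodal (S.erase t) (id : ℝ → ℝ) with hq
    have hq0 : q ≠ 0 := Lagrange.nodal_ne_zero
    have h1 := hW' q hq0 (by rw [hdeg ht]; omega)
    have h2 : 0 < L (((X - C c) * q) * ((X - C c) * q)) := by
      apply hL _ (mul_ne_zero (X_sub_C_ne_zero c) hq0)
      rw [(monic_X_sub_C c).natDegree_mul' hq0, natDegree_X_sub_C, hdeg ht]
      omega
    have h3 := ho' q (by rw [hdeg ht]; omega)
    -- One factor `X - c` is split as `(X - t) + (t - c)`, and `(X - t) q` is the nodal polynomial.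
    -- Hence `L ((X - c)² q²) = (t - c) L ((X - c) q²)`, which fixes the sign of `t - c`.
    have h4 : ((X - C c) * q) * ((X - C c) * q) =
        (X - C c) * (Lagrange.nodal S id * q) + C (t - c) * ((X - C c) * (q * q)) := by
      rw [nodal_eq_sub_mul_erase ht, C_sub]
      ring
    rw [h4, map_add, h3, hscal, zero_add] at h2
    have h5 : 0 < (σ * (t - c)) * (L ((X - C c) * (q * q))) ^ 2 := by
      have := mul_pos h1 h2
      linarith
    exact pos_of_mul_pos_left h5 (sq_nonneg _)
  have hc : c ∉ S := fun h => by simpa using hpos c h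
  refine ⟨hc, hpos, fun t => L (Lagrange.basis (insert c S) id t), ?_⟩
  have hnod : Lagrange.nodal (insert c S) (id : ℝ → ℝ) = (X - C c) * Lagrange.nodal S id :=
    Lagrange.nodal_insert_eq_nodal (v := id) hc
  have hquad : ∀ f : ℝ[X], f.natDegree ≤ 2 * m → L f =
      ∑ t ∈ insert c S, L (Lagrange.basis (insert c S) id t) * f.eval t := by
    intro f hf
    refine eq_sum_eval_of_nodal (d := 2 * m) (fun q hq => ?_) hf
    rw [Finset.card_insert_of_notMem hc] at hq
    rw [hnod, mul_assoc]
    exact ho' q (by omega)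
  refine ⟨fun t ht => ?_, hquad⟩
  -- Test polynomials that vanish at all other nodes isolate a weight: the squared nodal polynomial
  -- of `S` for `c`, and `(X - c) q²` for `t ∈ S`.
  rcases Finset.mem_insert.1 ht with rfl | htS
  · have hp0 : Lagrange.nodal S (id : ℝ → ℝ) ≠ 0 := Lagrange.nodal_ne_zero
    have h1 : 0 < L (Lagrange.nodal S id * Lagrange.nodal S id) :=
      hL _ hp0 (by rw [Lagrange.natDegree_nodal]; omega)
    rw [hquad _ (by rw [natDegree_mul hp0 hp0, Lagrange.natDegree_nodal]; omega),
      Finset.sum_insert hc, Finset.sum_eq_zero fun s hs => by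
        rw [eval_mul, eval_nodal_eq_zero hs, zero_mul, mul_zero], add_zero, eval_mul] at h1
    exact pos_of_mul_pos_left h1 (mul_self_nonneg _)
  · set q := Lagrange.nodal (S.erase t) (id : ℝ → ℝ) with hq
    have hq0 : q ≠ 0 := Lagrange.nodal_ne_zero
    have h1 := hW' q hq0 (by rw [hdeg htS]; omega)
    rw [hquad _ (by
      rw [(monic_X_sub_C c).natDegree_mul' (mul_ne_zero hq0 hq0), natDegree_mul hq0 hq0,
        natDegree_X_sub_C, hdeg htS]
      omega), Finset.sum_eq_single_of_mem t ht] at h1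
    · rw [eval_mul, eval_mul, eval_sub, eval_X, eval_C] at h1
      have h2 : 0 < L (Lagrange.basis (insert c S) id t) *
          ((σ * (t - c)) * (q.eval t * q.eval t)) := by linarith
      exact pos_of_mul_pos_left h2 (mul_nonneg (hpos t htS).le (mul_self_nonneg _))
    · intro s hs hst
      rcases Finset.mem_insert.1 hs with rfl | hsS
      · simp
      · rw [eval_mul, eval_mul, eval_nodal_eq_zero (Finset.mem_erase.2 ⟨hst, hsS⟩)]
        simp

end

/-! ### Hankel matrices and determinants. -/

section

open Polynomial Matrix

/-- The polynomial with coefficient vector `v`. -/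
def vecPoly {n : ℕ} (v : Fin n → ℝ) : ℝ[X] :=
  ∑ i, C (v i) * X ^ (i : ℕ)

theorem vecPoly_coeff {n : ℕ} {q : ℝ[X]} (hq : q.natDegree < n) :
    vecPoly (fun i : Fin n => q.coeff i) = q := by
  rw [vecPoly, Fin.sum_univ_eq_sum_range (fun i => C (q.coeff i) * X ^ i) n]
  exact (q.as_sum_range_C_mul_X_pow' hq).symm

theorem coeff_vecPoly {n : ℕ} (v : Fin n → ℝ) (i : Fin n) : (vecPoly v).coeff i = v i := by
  simp [vecPoly, finsetSum_coeff, coeff_X_pow, Fin.val_inj]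

theorem vecPoly_ne_zero {n : ℕ} {v : Fin n → ℝ} (hv : v ≠ 0) : vecPoly v ≠ 0 := by
  intro h
  refine hv (funext fun i => ?_)
  rw [← coeff_vecPoly v i, h]
  simp

theorem natDegree_vecPoly_lt {n : ℕ} (hn : 0 < n) (v : Fin n → ℝ) :
    (vecPoly v).natDegree < n := by
  refine (natDegree_sum_le_of_forall_le (n := n - 1) _ _ fun i _ => ?_).trans_lt (by omega)
  exact (natDegree_C_mul_X_pow_le _ _).trans (by omega)

/-- The Hankel matrix is the Gram matrix of the monomials, so matrix positivity is positivity of the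
functional on squares. -/
theorem dotProduct_hankel_mulVec (b : ℕ → ℝ) {n : ℕ} (v w : Fin n → ℝ) :
    v ⬝ᵥ hankel b n *ᵥ w = momentFunctional b (vecPoly v * vecPoly w) := by
  simp only [vecPoly, Finset.sum_mul_sum, map_sum]
  simp only [dotProduct, mulVec, hankel, of_apply, Finset.mul_sum]
  refine Finset.sum_congr rfl fun i _ => Finset.sum_congr rfl fun j _ => ?_
  rw [show C (v i) * X ^ (i : ℕ) * (C (w j) * X ^ (j : ℕ)) =
    C (v i * w j) * X ^ ((i : ℕ) + (j : ℕ)) by rw [C_mul, pow_add]; ring,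
    momentFunctional_C_mul, momentFunctional_X_pow]
  ring

theorem isHermitian_hankel (b : ℕ → ℝ) (n : ℕ) : (hankel b n).IsHermitian := by
  ext i j
  simp [hankel, add_comm]

theorem posSemidef_hankel_iff (b : ℕ → ℝ) {n : ℕ} (hn : 0 < n) :
    (hankel b n).PosSemidef ↔
      ∀ q : ℝ[X], q.natDegree < n → 0 ≤ momentFunctional b (q * q) := by
  constructor
  · intro h q hq
    have := h.dotProduct_mulVec_nonneg fun i : Fin n => q.coeff i
    rwa [star_trivial, dotProduct_hankel_mulVec, vecPoly_coeff hq] at this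
  · intro h
    refine PosSemidef.of_dotProduct_mulVec_nonneg (isHermitian_hankel b n) fun v => ?_
    rw [star_trivial, dotProduct_hankel_mulVec]
    exact h _ (natDegree_vecPoly_lt hn v)

theorem hankelDet_pos_of_posOn {b : ℕ → ℝ} {n : ℕ} (h : PosOn (momentFunctional b) n) :
    0 < hankelDet b n := by
  rcases n.eq_zero_or_pos with rfl | hn
  · simp [hankelDet]
  · refine PosDef.det_pos (PosDef.of_dotProduct_mulVec_pos (isHermitian_hankel b n) fun v hv => ?_)
    rw [star_trivial, dotProduct_hankel_mulVec]
    exact h _ (vecPoly_ne_zero hv) (natDegree_vecPoly_lt hn v)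

theorem posOn_of_hankelDet_pos {b : ℕ → ℝ} {n : ℕ} (h : (hankel b n).PosSemidef)
    (hd : 0 < hankelDet b n) : PosOn (momentFunctional b) n := by
  intro q hq hqn
  have hv : (fun i : Fin n => q.coeff i) ≠ 0 := by
    intro h0
    apply hq
    rw [← vecPoly_coeff hqn, h0]
    simp [vecPoly]
  have := (h.posDef_iff_det_ne_zero.2 hd.ne').dotProduct_mulVec_pos hv
  rwa [star_trivial, dotProduct_hankel_mulVec, vecPoly_coeff hqn] at this

theorem exists_null_of_hankelDet_not_pos {b : ℕ → ℝ} {n : ℕ} (hn : 0 < n)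
    (h : (hankel b n).PosSemidef) (hd : ¬ 0 < hankelDet b n) :
    ∃ q : ℝ[X], q ≠ 0 ∧ q.natDegree < n ∧ momentFunctional b (q * q) = 0 := by
  have h0 : (hankel b n).det = 0 := by
    by_contra hne
    exact hd (h.posDef_iff_det_ne_zero.2 hne).det_pos
  obtain ⟨v, hv, hv0⟩ := exists_mulVec_eq_zero_iff.2 h0
  refine ⟨vecPoly v, vecPoly_ne_zero hv, natDegree_vecPoly_lt hn v, ?_⟩
  rw [← dotProduct_hankel_mulVec, hv0, dotProduct_zero]

/-- Lets the complex hypotheses (b) and (c) be applied to real polynomials, the only vectors needed.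
-/
theorem hankelForm_coeff (c : ℕ → ℝ) {r : ℕ} {q : ℝ[X]} (hq : q.natDegree ≤ r) :
    hankelForm c r (fun i => (q.coeff i : ℂ)) = (momentFunctional c (q * q) : ℂ) := by
  have hq' : q.natDegree < r + 1 := by omega
  conv_rhs => rw [← vecPoly_coeff hq', ← dotProduct_hankel_mulVec]
  simp only [hankelForm, dotProduct, mulVec, hankel, of_apply]
  rw [Fin.sum_univ_eq_sum_range
    (fun i => q.coeff i * ∑ j : Fin (r + 1), c (i + (j : ℕ)) * q.coeff j) (r + 1)]
  push_cast
  refine Finset.sum_congr rfl fun i _ => ?_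
  rw [Fin.sum_univ_eq_sum_range (fun j => (c (i + j) * q.coeff j : ℂ)) (r + 1), Finset.mul_sum]
  refine Finset.sum_congr rfl fun j _ => ?_
  rw [Complex.conj_ofReal]
  ring

/-- The determinant of the Hankel matrix with last row replaced by `1, X, …, X ^ n`. -/
def detPoly (b : ℕ → ℝ) (n : ℕ) : ℝ[X] :=
  vecPoly fun j : Fin (n + 1) =>
    (-1) ^ (n + j : ℕ) * ((hankel b (n + 1)).submatrix (Fin.last n).succAbove j.succAbove).det

/-- Laplace expansion along the last row, whose cofactors are the coefficients of `detPoly`. Powers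
of `t` as `v` give evaluation; Hankel rows give orthogonality. -/
theorem det_updateRow_hankel (b : ℕ → ℝ) (n : ℕ) (v : Fin (n + 1) → ℝ) :
    ((hankel b (n + 1)).updateRow (Fin.last n) v).det =
      ∑ j : Fin (n + 1), (detPoly b n).coeff j * v j := by
  rw [det_succ_row _ (Fin.last n)]
  refine Finset.sum_congr rfl fun j _ => ?_
  rw [submatrix_updateRow_succAbove, updateRow_self, detPoly, coeff_vecPoly, Fin.val_last]
  ring

theorem natDegree_detPoly_lt (b : ℕ → ℝ) (n : ℕ) : (detPoly b n).natDegree < n + 1 :=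
  natDegree_vecPoly_lt n.succ_pos _

theorem coeff_detPoly_self (b : ℕ → ℝ) (n : ℕ) : (detPoly b n).coeff n = hankelDet b n := by
  have := coeff_vecPoly (fun j : Fin (n + 1) => (-1) ^ (n + j : ℕ) *
    ((hankel b (n + 1)).submatrix (Fin.last n).succAbove j.succAbove).det) (Fin.last n)
  rw [Fin.val_last] at this
  rw [detPoly, this, ← two_mul, pow_mul, neg_one_sq, one_pow, one_mul, hankelDet]
  congr 1
  ext i j
  simp [hankel]

theorem orthPoly_eq (b : ℕ → ℝ) (n : ℕ) (t : ℝ) :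
    orthPoly b n t = 1 / √(hankelDet b (n + 1) * hankelDet b n) * (detPoly b n).eval t := by
  rw [orthPoly]
  congr 1
  rw [eval_eq_sum_range' (natDegree_detPoly_lt b n),
    ← Fin.sum_univ_eq_sum_range (fun j => (detPoly b n).coeff j * t ^ j),
    ← det_updateRow_hankel b n fun j => t ^ (j : ℕ)]
  congr 1
  ext i j
  by_cases h : i = Fin.last n
  · simp [h]
  · simp [h, hankel, updateRow_apply]

/-- Pairing with `X ^ i` puts row `i` of the Hankel matrix in the last place: a repeated row if `i <
n`, the original matrix if `i = n`. -/
theorem momentFunctional_detPoly_mul_X_pow (b : ℕ → ℝ) (n : ℕ) {i : ℕ} (hi : i ≤ n) :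
    momentFunctional b (detPoly b n * X ^ i) = if i = n then hankelDet b (n + 1) else 0 := by
  have h : momentFunctional b (detPoly b n * X ^ i) =
      ((hankel b (n + 1)).updateRow (Fin.last n)
        (hankel b (n + 1) ⟨i, by omega⟩)).det := by
    refine Eq.trans ?_ (det_updateRow_hankel b n _).symm
    refine Eq.trans ?_ (Fin.sum_univ_eq_sum_range
      (fun j => (detPoly b n).coeff j * b (i + j)) (n + 1)).symm
    conv_lhs => rw [(detPoly b n).as_sum_range_C_mul_X_pow' (natDegree_detPoly_lt b n)]
    rw [Finset.sum_mul, map_sum]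
    refine Finset.sum_congr rfl fun j _ => ?_
    rw [mul_assoc, ← pow_add, momentFunctional_C_mul, momentFunctional_X_pow, add_comm]
  rw [h]
  split_ifs with hin
  · subst hin
    rw [show (⟨i, by omega⟩ : Fin (i + 1)) = Fin.last i from rfl, updateRow_eq_self]
    rfl
  · exact det_updateRow_eq_zero fun h => hin (by simpa using congrArg Fin.val h)

/-- Dividing a polynomial of degree `n` by its leading coefficient makes it monic. -/
theorem exists_monic_smul {p : ℝ[X]} {n : ℕ} (hp : p.natDegree < n + 1) (hc : p.coeff n ≠ 0) :
    (C (p.coeff n)⁻¹ * p).Monic ∧ (C (p.coeff n)⁻¹ * p).natDegree = n := by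
  have hd : (C (p.coeff n)⁻¹ * p).natDegree = n := by
    rw [natDegree_C_mul (inv_ne_zero hc)]
    exact le_antisymm (by omega) (le_natDegree_of_ne_zero hc)
  refine ⟨?_, hd⟩
  rw [Monic, leadingCoeff, hd, coeff_C_mul, inv_mul_cancel₀ hc]

/-- A functional that is positive definite in degrees below `n` has a monic orthogonal polynomial
of degree `n`. -/
theorem exists_monic_orthTo {b : ℕ → ℝ} {n : ℕ} (h : PosOn (momentFunctional b) n) :
    ∃ p : ℝ[X], p.Monic ∧ p.natDegree = n ∧ OrthTo (momentFunctional b) p n := by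
  have hpos := hankelDet_pos_of_posOn h
  rw [← coeff_detPoly_self] at hpos
  obtain ⟨h1, h2⟩ := exists_monic_smul (natDegree_detPoly_lt b n) hpos.ne'
  refine ⟨_, h1, h2, OrthTo.of_X_pow fun i hi => ?_⟩
  rw [mul_assoc, momentFunctional_C_mul, momentFunctional_detPoly_mul_X_pow b n hi.le,
    if_neg hi.ne, mul_zero]

/-- In the definite case the ratio is `1 - Q / P`, with `P` and `Q` the monic orthogonal
polynomials of degree `m` of the given and of the shifted sequence. -/
theorem exists_orthogonal_pair {b : ℕ → ℝ} {m : ℕ} (hm : 1 ≤ m)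
    (hL : PosOn (momentFunctional b) (m + 1)) (hS : PosOn (momentFunctional (shift b)) m) :
    ∃ P Q : ℝ[X], (P.Monic ∧ P.natDegree = m ∧ OrthTo (momentFunctional b) P m) ∧
      (Q.Monic ∧ Q.natDegree = m ∧ OrthTo (momentFunctional (shift b)) Q m) ∧
      ∀ x, (orthPoly b m x ≠ 0 ↔ P.eval x ≠ 0) ∧
        (P.eval x ≠ 0 → ratio b m x = 1 - Q.eval x / P.eval x) := by
  obtain ⟨k, rfl⟩ : ∃ k, m = k + 1 := ⟨m - 1, by omega⟩
  have hΔ2 : 0 < hankelDet b (k + 1 + 1) := hankelDet_pos_of_posOn hL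
  have hΔ1 : 0 < hankelDet b (k + 1) :=
    hankelDet_pos_of_posOn fun q hq hqd => hL q hq (by omega)
  have hs1 : 0 < hankelDet (shift b) (k + 1) := hankelDet_pos_of_posOn hS
  have hs0 : 0 < hankelDet (shift b) k :=
    hankelDet_pos_of_posOn fun q hq hqd => hS q hq (by omega)
  set A := detPoly b (k + 1) with hA
  set B := detPoly (shift b) k with hB
  -- Under the shifted functional `A` and `B` are orthogonal to `X ^ i` for `i < k`, and their
  -- pairings with `X ^ k` are `Δ_m` and `Δ^1_{m-1}`. This `κ` makes `A - κ B` orthogonal to `X ^ k`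
  -- too.
  set κ := hankelDet b (k + 1 + 1) / hankelDet (shift b) (k + 1) with hκ
  have hAc : A.coeff (k + 1) = hankelDet b (k + 1) := coeff_detPoly_self _ _
  have hAd : A.natDegree < k + 1 + 1 := natDegree_detPoly_lt _ _
  have hBd : B.natDegree < k + 1 := natDegree_detPoly_lt _ _
  have hDc : (A - C κ * B).coeff (k + 1) = hankelDet b (k + 1) := by
    rw [coeff_sub, coeff_C_mul, coeff_eq_zero_of_natDegree_lt hBd, hAc, mul_zero, sub_zero]
  have hDd : (A - C κ * B).natDegree < k + 1 + 1 := by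
    have h1 := natDegree_sub_le A (C κ * B)
    have h2 := natDegree_C_mul_le κ B
    have h3 := max_lt hAd (h2.trans_lt (hBd.trans (Nat.lt_succ_self _)))
    exact h1.trans_lt h3
  have hPm := exists_monic_smul hAd (by rw [hAc]; exact hΔ1.ne')
  have hQm := exists_monic_smul hDd (by rw [hDc]; exact hΔ1.ne')
  rw [hAc] at hPm
  rw [hDc] at hQm
  refine ⟨_, _, ⟨hPm.1, hPm.2, ?_⟩, ⟨hQm.1, hQm.2, ?_⟩, fun x => ⟨?_, fun hx => ?_⟩⟩
  · refine OrthTo.of_X_pow fun i hi => ?_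
    rw [mul_assoc, momentFunctional_C_mul, momentFunctional_detPoly_mul_X_pow _ _ hi.le,
      if_neg hi.ne, mul_zero]
  · refine OrthTo.of_X_pow fun i hi => ?_
    rw [mul_assoc, momentFunctional_C_mul, sub_mul, map_sub, mul_assoc, momentFunctional_C_mul,
      momentFunctional_detPoly_mul_X_pow _ _ (by omega), momentFunctional_shift,
      show X * (A * X ^ i) = A * X ^ (i + 1) by ring,
      momentFunctional_detPoly_mul_X_pow _ _ (by omega)]
    simp only [add_left_inj, hκ]
    split_ifs
    · field_simp
      simp
    · simp
  · rw [orthPoly_eq, eval_mul, eval_C, mul_ne_zero_iff, mul_ne_zero_iff]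
    have h1 : 1 / √(hankelDet b (k + 1 + 1) * hankelDet b (k + 1)) ≠ 0 := by positivity
    have h2 : (hankelDet b (k + 1))⁻¹ ≠ 0 := by positivity
    tauto
  · rw [eval_mul, eval_C] at hx
    have hAx : A.eval x ≠ 0 := right_ne_zero_of_mul hx
    rw [ratio, orthPoly_eq, orthPoly_eq, Nat.add_sub_cancel, eval_mul, eval_mul, eval_C,
      eval_sub, eval_mul, eval_C, ← hA, ← hB]
    -- The prefactor and both normalisations collapse to `κ`, so the ratio is `κ B / A = 1 - (A - κ
    -- B) / A`.
    have hroot : √(hankelDet b (k + 1 + 1) * hankelDet (shift b) k /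
        (hankelDet b (k + 1) * hankelDet (shift b) (k + 1))) *
        (1 / √(hankelDet (shift b) (k + 1) * hankelDet (shift b) k) /
          (1 / √(hankelDet b (k + 1 + 1) * hankelDet b (k + 1)))) = κ := by
      rw [div_div_div_eq, one_mul, mul_one, ← Real.sqrt_div (by positivity), ← Real.sqrt_mul (by positivity),
        Real.sqrt_eq_iff_mul_self_eq (by positivity) (by positivity), hκ]
      field_simp
    rw [mul_div_mul_comm (1 / _), ← mul_assoc, hroot]
    field_simp
    ring

end

/-! ### Solutions as measures, and uniqueness from a null polynomial. -/

section

open Polynomial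

/-- A quadrature formula with non-negative weights and nodes in `[0, Λ]` is a solution. -/
theorem isSolution_sum_dirac {b : ℕ → ℝ} {m : ℕ} {Λ : ℝ} {S : Finset ℝ} {w : ℝ → ℝ}
    (hS : ∀ t ∈ S, t ∈ Set.Icc 0 Λ) (hw : ∀ t ∈ S, 0 ≤ w t)
    (h : ∀ f : ℝ[X], f.natDegree ≤ 2 * m → momentFunctional b f = ∑ t ∈ S, w t * f.eval t) :
    IsSolution b m Λ (∑ t ∈ S, ENNReal.ofReal (w t) • Measure.dirac t) := by
  refine ⟨⟨?_⟩, ?_, fun k hk => ?_⟩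
  · simp [Measure.finsetSum_apply]
  · rw [Measure.finsetSum_apply]
    refine Finset.sum_eq_zero fun t ht => ?_
    rw [Measure.smul_apply, Measure.dirac_apply' _ measurableSet_Icc.compl]
    simp [hS t ht]
  · rw [integral_finsetSum_measure]
    · rw [← momentFunctional_X_pow b k, h _ (by simpa using hk)]
      refine Finset.sum_congr rfl fun t ht => ?_
      rw [integral_smul_measure, integral_dirac, ENNReal.toReal_ofReal (hw t ht)]
      simp
    · intro t _
      exact (integrable_dirac (by finiteness)).smul_measure ENNReal.ofReal_ne_top

namespace IsSolution

variable {b : ℕ → ℝ} {m : ℕ} {Λ : ℝ} {μ ν : Measure ℝ}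

theorem ae_mem (h : IsSolution b m Λ μ) : ∀ᵐ t ∂μ, t ∈ Set.Icc 0 Λ :=
  mem_ae_iff.2 h.2.1

theorem integrable_eval (h : IsSolution b m Λ μ) (f : ℝ[X]) :
    Integrable (fun t => f.eval t) μ := by
  have := h.1
  have h1 : IntegrableOn (fun t => f.eval t) (Set.Icc 0 Λ) μ :=
    f.continuous.continuousOn.integrableOn_compact isCompact_Icc
  rwa [IntegrableOn, Measure.restrict_eq_self_of_ae_mem h.ae_mem] at h1

theorem integral_eval (h : IsSolution b m Λ μ) {f : ℝ[X]} (hf : f.natDegree ≤ 2 * m) :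
    ∫ t, f.eval t ∂μ = momentFunctional b f := by
  rw [momentFunctional_eq_sum b (n := 2 * m + 1) (by omega)]
  simp_rw [eval_eq_sum_range' (show f.natDegree < 2 * m + 1 by omega)]
  rw [integral_finsetSum]
  · refine Finset.sum_congr rfl fun i hi => ?_
    rw [integral_const_mul, h.2.2 i (by have := Finset.mem_range.1 hi; omega)]
  · intro i _
    have := h.integrable_eval (X ^ i)
    simp only [eval_pow, eval_X] at this
    exact this.const_mul _

theorem momentFunctional_nonneg (h : IsSolution b m Λ μ) {f : ℝ[X]} (hf : f.natDegree ≤ 2 * m)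
    (h0 : ∀ t ∈ Set.Icc 0 Λ, 0 ≤ f.eval t) : 0 ≤ momentFunctional b f := by
  rw [← h.integral_eval hf]
  exact integral_nonneg_of_ae (h.ae_mem.mono fun t ht => h0 t ht)

theorem ae_eval_eq_zero (h : IsSolution b m Λ μ) {f : ℝ[X]} (hf : f.natDegree ≤ 2 * m)
    (h0 : ∀ t ∈ Set.Icc 0 Λ, 0 ≤ f.eval t) (hz : momentFunctional b f = 0) :
    ∀ᵐ t ∂μ, f.eval t = 0 := by
  rw [← h.integral_eval hf,
    integral_eq_zero_iff_of_nonneg_ae (h.ae_mem.mono fun t ht => h0 t ht)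
      (h.integrable_eval f)] at hz
  exact hz

theorem momentFunctional_eq_zero (h : IsSolution b m Λ μ) {f : ℝ[X]} (hf : f.natDegree ≤ 2 * m)
    (h0 : ∀ᵐ t ∂μ, f.eval t = 0) : momentFunctional b f = 0 := by
  rw [← h.integral_eval hf]
  exact integral_eq_zero_of_ae h0

/-- If a non-zero polynomial of degree at most `m` vanishes almost everywhere, the moment
functional is not positive definite in degree `m`. -/
theorem not_ae_eval_eq_zero (h : IsSolution b m Λ μ)
    (hL : PosOn (momentFunctional b) (m + 1)) {q : ℝ[X]} (hq : q ≠ 0) (hd : q.natDegree ≤ m) :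
    ¬ ∀ᵐ t ∂μ, q.eval t = 0 := by
  intro h0
  refine (hL q hq (by omega)).ne' (h.momentFunctional_eq_zero ?_ ?_)
  · rw [natDegree_mul hq hq]
    omega
  · filter_upwards [h0] with t ht
    rw [eval_mul, ht, zero_mul]

/-- On `S` the Lagrange basis polynomial of `a` is the indicator of `a`, and its degree `S.card - 1`
is within the known moments. -/
theorem measureReal_singleton (h : IsSolution b m Λ μ) {S : Finset ℝ} (hS : S.card ≤ 2 * m + 1)
    (hμ : ∀ᵐ t ∂μ, t ∈ S) {a : ℝ} (ha : a ∈ S) :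
    μ.real {a} = momentFunctional b (Lagrange.basis S id a) := by
  rw [← h.integral_eval (by
    rw [Lagrange.natDegree_basis (Set.injOn_id _) ha]
    omega), ← integral_indicator_one (measurableSet_singleton a)]
  refine integral_congr_ae ?_
  filter_upwards [hμ] with t ht
  by_cases hta : t = a
  · subst hta
    have := Lagrange.eval_basis_self (v := id) (Set.injOn_id (S : Set ℝ)) ht
    simp only [id] at this
    simp [this]
  · have := Lagrange.eval_basis_of_ne (v := id) (Ne.symm hta) ht
    simp only [id] at this
    simp [this, hta]

theorem eq_of_ae_mem (h : IsSolution b m Λ μ) (h' : IsSolution b m Λ ν) {S : Finset ℝ}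
    (hS : S.card ≤ 2 * m + 1) (hμ : ∀ᵐ t ∂μ, t ∈ S) (hν : ∀ᵐ t ∂ν, t ∈ S) : μ = ν := by
  classical
  have := h.1
  have := h'.1
  have hsing : ∀ a ∈ S, μ {a} = ν {a} := fun a ha => by
    rw [← measureReal_eq_measureReal_iff, h.measureReal_singleton hS hμ ha,
      h'.measureReal_singleton hS hν ha]
  have key : ∀ (ρ : Measure ℝ), (∀ᵐ t ∂ρ, t ∈ S) → ∀ A : Set ℝ,
      ρ A = ∑ a ∈ S with a ∈ A, ρ {a} := by
    intro ρ hρ A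
    rw [sum_measure_singleton]
    refine measure_congr ?_
    filter_upwards [hρ] with t ht
    apply propext
    change t ∈ A ↔ t ∈ ((S.filter (· ∈ A) : Finset ℝ) : Set ℝ)
    simp [ht]
  ext A _
  rw [key μ hμ, key ν hν]
  exact Finset.sum_congr rfl fun a ha => hsing a (Finset.mem_filter.1 ha).1

/-- If a non-zero polynomial of degree at most `2m`, non-negative on `[0, Λ]`, is annihilated by
the moment functional, then there is at most one solution. -/
theorem eq_of_null (h : IsSolution b m Λ μ) (h' : IsSolution b m Λ ν) {f : ℝ[X]} (hf0 : f ≠ 0)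
    (hf : f.natDegree ≤ 2 * m) (h0 : ∀ t ∈ Set.Icc 0 Λ, 0 ≤ f.eval t)
    (hz : momentFunctional b f = 0) : μ = ν := by
  classical
  refine h.eq_of_ae_mem h' (S := f.roots.toFinset) ?_ ?_ ?_
  · have h1 := f.roots.toFinset_card_le
    have h2 := f.card_roots'
    omega
  · exact (h.ae_eval_eq_zero hf h0 hz).mono fun t ht => by simpa [hf0] using ht
  · exact (h'.ae_eval_eq_zero hf h0 hz).mono fun t ht => by simpa [hf0] using ht

end IsSolution

end

/-! ### The degenerate case. -/

section

open Polynomial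

/-- The null space of a positive semidefinite functional is contained in its kernel. -/
theorem orthTo_of_null {M : ℝ[X] →ₗ[ℝ] ℝ} {n : ℕ}
    (hM : ∀ q : ℝ[X], q.natDegree < n → 0 ≤ M (q * q)) {p : ℝ[X]} (hp : p.natDegree < n)
    (h0 : M (p * p) = 0) : OrthTo M p n := by
  intro q hq
  -- `M ((q + s p)²)` is affine in `s` because `M (p²) = 0`; being non-negative for all `s`, it has
  -- zero slope.
  have key : ∀ s : ℝ, 0 ≤ M (q * q) + s * (2 * M (p * q)) := by
    intro s
    have h1 := hM (q + s • p) ((natDegree_add_le _ _).trans_lt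
      (max_lt hq ((natDegree_smul_le s p).trans_lt hp)))
    have h2 : (q + s • p) * (q + s • p) = q * q + (s * 2) • (p * q) + (s ^ 2) • (p * p) := by
      simp only [smul_eq_C_mul, C_mul, C_pow, C_ofNat]
      ring
    rw [h2, map_add, map_add, map_smul, map_smul, h0, smul_eq_mul, smul_eq_mul] at h1
    linarith
  by_contra hne
  have h1 := key (-(M (q * q) + 1) / (2 * M (p * q)))
  rw [div_mul_cancel₀ _ (mul_ne_zero two_ne_zero hne)] at h1
  linarith

theorem natDegree_nodal_erase {S : Finset ℝ} {t : ℝ} (ht : t ∈ S) :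
    (Lagrange.nodal (S.erase t) (id : ℝ → ℝ)).natDegree + 1 = S.card := by
  rw [Lagrange.natDegree_nodal, Finset.card_erase_add_one ht]

/-- In the degenerate case the roots of the null polynomial of least degree carry a solution. -/
theorem exists_isSolution_of_null {b : ℕ → ℝ} {m : ℕ} {Λ : ℝ}
    (ha : ∀ q : ℝ[X], q.natDegree < m + 1 → 0 ≤ momentFunctional b (q * q))
    (hb : ∀ q : ℝ[X], q.natDegree < m → momentFunctional b (q * q) = 0 →
      momentFunctional b (X * q * (X * q)) = 0)
    (hc : ∀ q : ℝ[X], q.natDegree < m → 0 ≤ momentFunctional b (X * (q * q)))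
    (hΛ : ∀ q : ℝ[X], q.natDegree < m → 0 ≤ momentFunctional b ((C Λ - X) * (q * q)))
    (hnull : ∃ q : ℝ[X], q ≠ 0 ∧ q.natDegree < m + 1 ∧ momentFunctional b (q * q) = 0) :
    ∃ μ, IsSolution b m Λ μ := by
  classical
  have hmonic : ∀ q : ℝ[X], q ≠ 0 → momentFunctional b (q * q) = 0 →
      ∃ p : ℝ[X], p.Monic ∧ p.natDegree = q.natDegree ∧ momentFunctional b (p * p) = 0 := by
    intro q hq h0
    obtain ⟨h1, h2⟩ := exists_monic_smul (p := q) (Nat.lt_succ_self _)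
      (leadingCoeff_ne_zero.2 hq)
    refine ⟨_, h1, h2, ?_⟩
    rw [mul_mul_mul_comm, ← C_mul, momentFunctional_C_mul, h0, mul_zero]
  have hex : ∃ r, ∃ p : ℝ[X], p.Monic ∧ p.natDegree = r ∧ momentFunctional b (p * p) = 0 := by
    obtain ⟨q, hq, _, h0⟩ := hnull
    obtain ⟨p, hp⟩ := hmonic q hq h0
    exact ⟨_, p, hp⟩
  obtain ⟨p, hp, hpr, hp0⟩ := Nat.find_spec hex
  set r := Nat.find hex with hr
  have hrm : r ≤ m := by
    obtain ⟨q, hq, hqd, h0⟩ := hnull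
    obtain ⟨p', hp'⟩ := hmonic q hq h0
    exact (Nat.find_min' hex ⟨p', hp'⟩).trans (by omega)
  have hpos : PosOn (momentFunctional b) r := by
    intro q hq hqr
    refine (ha q (by omega)).lt_of_ne' fun h0 => ?_
    exact Nat.find_min hex hqr (hmonic q hq h0)
  have hXd : ∀ k, (X ^ k * p).natDegree = k + r := fun k => by
    rw [(monic_X_pow k).natDegree_mul hp, natDegree_X_pow, hpr]
  have hXnull : ∀ k, k + r ≤ m → momentFunctional b (X ^ k * p * (X ^ k * p)) = 0 := by
    intro k
    induction k with
    | zero => intro _; simpa using hp0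
    | succ k ih =>
      intro hk
      have := hb (X ^ k * p) (by rw [hXd]; omega) (ih (by omega))
      rwa [← mul_assoc X, ← pow_succ'] at this
  -- Split `X ^ i p` as `(X ^ (i - m) p) X ^ (min i m)`, with truncated subtraction. The first
  -- factor is null of degree at most `m`, hence orthogonal to the second.
  have ho : OrthTo (momentFunctional b) p (2 * m - r + 1) := by
    refine OrthTo.of_X_pow fun i hi => ?_
    have h1 := orthTo_of_null ha (p := X ^ (i - m) * p) (by rw [hXd]; omega)
      (hXnull (i - m) (by omega)) (X ^ (min i m)) (by rw [natDegree_X_pow]; omega)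
    rw [mul_right_comm, ← pow_add, show i - m + min i m = i by omega, mul_comm] at h1
    exact h1
  obtain ⟨S, rfl, hS⟩ := OrthTo.exists_nodal hpos hp hpr fun q hq => ho q (by omega)
  have hquad : ∀ f : ℝ[X], f.natDegree ≤ 2 * m → momentFunctional b f =
      ∑ t ∈ S, momentFunctional b (Lagrange.basis S id t) * f.eval t := fun f hf =>
    eq_sum_eval_of_nodal (d := 2 * m) (fun q hq => ho q (by omega)) hf
  refine ⟨_, isSolution_sum_dirac ?_ ?_ hquad⟩
  · intro t ht
    set q := Lagrange.nodal (S.erase t) (id : ℝ → ℝ) with hq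
    have hqd := natDegree_nodal_erase ht
    rw [hS, ← hq] at hqd
    have h1 : 0 < momentFunctional b (q * q) := hpos q Lagrange.nodal_ne_zero (by omega)
    have h2 := ho q (by omega)
    rw [nodal_eq_sub_mul_erase ht, ← hq] at h2
    have h3 := hc q (by omega)
    have h4 := hΛ q (by omega)
    -- Since `L ((X - t) q²) = 0`, the weights `X` and `Λ - X` act on `q²` as the numbers `t` and `Λ
    -- - t`.
    rw [show X * (q * q) = (X - C t) * q * q + C t * (q * q) by ring, map_add, h2,
      momentFunctional_C_mul, zero_add] at h3
    rw [show (C Λ - X) * (q * q) = -((X - C t) * q * q) + C (Λ - t) * (q * q) by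
      rw [C_sub]; ring, map_add, map_neg, h2, momentFunctional_C_mul, neg_zero, zero_add] at h4
    exact ⟨nonneg_of_mul_nonneg_left h3 h1, sub_nonneg.1 (nonneg_of_mul_nonneg_left h4 h1)⟩
  · intro t ht
    set q := Lagrange.nodal (S.erase t) (id : ℝ → ℝ) with hq
    have hqd := natDegree_nodal_erase ht
    rw [hS, ← hq] at hqd
    have hq0 : q ≠ 0 := Lagrange.nodal_ne_zero
    have h1 : 0 < momentFunctional b (q * q) := hpos q hq0 (by omega)
    rw [hquad _ (by rw [natDegree_mul hq0 hq0]; omega), Finset.sum_eq_single_of_mem t ht,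
      eval_mul] at h1
    · exact (pos_of_mul_pos_left h1 (mul_self_nonneg _)).le
    · intro s hs hst
      rw [eval_mul, eval_nodal_eq_zero (Finset.mem_erase.2 ⟨hst, hs⟩)]
      simp

/-- A monic polynomial without roots beyond `Λ` is non-negative from `Λ` on. -/
theorem eval_nonneg_of_monic {f : ℝ[X]} (hf : f.Monic) {Λ : ℝ} (h : ∀ x, Λ < x → f.eval x ≠ 0)
    {x : ℝ} (hx : Λ ≤ x) : 0 ≤ f.eval x := by
  by_contra! hneg
  rcases f.natDegree.eq_zero_or_pos with hd | hd
  · rw [hf.natDegree_eq_zero.1 hd, eval_one] at hneg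
    linarith
  · have ht := f.tendsto_atTop_of_leadingCoeff_nonneg (natDegree_pos_iff_degree_pos.1 hd)
      (by rw [hf.leadingCoeff]; exact zero_le_one)
    obtain ⟨y, hy0, hxy⟩ := ((ht.eventually_ge_atTop 0).and
      (Filter.eventually_ge_atTop x)).exists
    obtain ⟨z, hz, hz0⟩ := intermediate_value_Icc hxy f.continuous.continuousOn ⟨hneg.le, hy0⟩
    refine h z (hx.trans_lt (hz.1.lt_of_ne ?_)) hz0
    rintro rfl
    exact hneg.ne hz0

theorem exists_eq_X_sub_C_mul {p : ℝ[X]} (hp : p.Monic) {x : ℝ} (hx : p.eval x = 0) :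
    ∃ q : ℝ[X], p = (X - C x) * q ∧ q ≠ 0 ∧ q.natDegree + 1 = p.natDegree := by
  obtain ⟨q, rfl⟩ := dvd_iff_isRoot.2 hx
  have hq : q ≠ 0 := right_ne_zero_of_mul hp.ne_zero
  refine ⟨q, rfl, hq, ?_⟩
  rw [(monic_X_sub_C x).natDegree_mul' hq, natDegree_X_sub_C, add_comm]

theorem natDegree_C_sub_X (x : ℝ) : (C x - X : ℝ[X]).natDegree = 1 := by
  compute_degree!

theorem C_sub_X_ne_zero (x : ℝ) : (C x - X : ℝ[X]) ≠ 0 := by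
  intro h
  have := natDegree_C_sub_X x
  simp [h] at this

/-! ### The definite case. -/

section Definite

variable {b : ℕ → ℝ} {m : ℕ} {Λ : ℝ} {P Q : ℝ[X]}

/-- If `P = (X - x) q`, then `(x - t) q²` is non-negative on `[0, Λ]` with integral `0`, so `P`
itself vanishes almost everywhere. Hence `x = Λ` is excluded too. -/
theorem IsSolution.eval_orthogonal_ne_zero {μ : Measure ℝ} (h : IsSolution b m Λ μ)
    (hL : PosOn (momentFunctional b) (m + 1)) (hP : P.Monic) (hPd : P.natDegree = m)
    (ho : OrthTo (momentFunctional b) P m) {x : ℝ} (hx : Λ ≤ x) : P.eval x ≠ 0 := by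
  intro h0
  obtain ⟨q, rfl, hq, hqd⟩ := exists_eq_X_sub_C_mul hP h0
  have h1 := ho q (by omega)
  refine h.not_ae_eval_eq_zero hL hP.ne_zero hPd.le ?_
  have h2 := h.ae_eval_eq_zero (f := (C x - X) * (q * q)) ?_ ?_ ?_
  · filter_upwards [h2] with t ht
    simp only [eval_mul, eval_sub, eval_C, eval_X, mul_eq_zero, sub_eq_zero] at ht ⊢
    tauto
  · rw [natDegree_mul (C_sub_X_ne_zero x) (mul_ne_zero hq hq), natDegree_mul hq hq,
      natDegree_C_sub_X]
    omega
  · intro t ht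
    simp only [eval_mul, eval_sub, eval_C, eval_X]
    exact mul_nonneg (sub_nonneg.2 (ht.2.trans hx)) (mul_self_nonneg _)
  · rw [show (C x - X) * (q * q) = -((X - C x) * q * q) by ring, map_neg, h1, neg_zero]

/-- The quotient of the shifted orthogonal polynomial by a linear factor gives a null element for
the weight `t (x - t)`. -/
theorem momentFunctional_weight_eq_zero {q : ℝ[X]} {x : ℝ}
    (ho : OrthTo (momentFunctional (shift b)) ((X - C x) * q) m) (hq : q.natDegree < m) :
    momentFunctional b (X * ((C x - X) * (q * q))) = 0 := by
  have := ho q hq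
  rw [momentFunctional_shift] at this
  rw [show X * ((C x - X) * (q * q)) = -(X * ((X - C x) * q * q)) by ring, map_neg, this,
    neg_zero]

theorem natDegree_weight_mul {q : ℝ[X]} (hq : q ≠ 0) (x : ℝ) :
    (X * ((C x - X) * (q * q))).natDegree = 2 * (q.natDegree + 1) := by
  rw [natDegree_mul X_ne_zero (mul_ne_zero (C_sub_X_ne_zero x) (mul_ne_zero hq hq)),
    natDegree_mul (C_sub_X_ne_zero x) (mul_ne_zero hq hq), natDegree_mul hq hq,
    natDegree_C_sub_X, natDegree_X]
  omega

theorem eval_weight_mul_nonneg (q : ℝ[X]) {x : ℝ} (hx : Λ ≤ x) {t : ℝ} (ht : t ∈ Set.Icc 0 Λ) :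
    0 ≤ (X * ((C x - X) * (q * q))).eval t := by
  simp only [eval_mul, eval_sub, eval_C, eval_X]
  exact mul_nonneg ht.1 (mul_nonneg (sub_nonneg.2 (ht.2.trans hx)) (mul_self_nonneg _))

/-- Here `t (x - t) q` vanishes almost everywhere, but its degree `m + 1` is out of reach of
definiteness. Strict `Λ < x` lets `x - t` be cancelled, leaving `t q` of degree `m`. -/
theorem IsSolution.eval_shifted_orthogonal_ne_zero {μ : Measure ℝ} (h : IsSolution b m Λ μ)
    (hL : PosOn (momentFunctional b) (m + 1)) (hQ : Q.Monic) (hQd : Q.natDegree = m)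
    (ho : OrthTo (momentFunctional (shift b)) Q m) {x : ℝ} (hx : Λ < x) : Q.eval x ≠ 0 := by
  intro h0
  obtain ⟨q, rfl, hq, hqd⟩ := exists_eq_X_sub_C_mul hQ h0
  refine h.not_ae_eval_eq_zero hL (mul_ne_zero X_ne_zero hq)
    (by rw [natDegree_X_mul hq]; omega) ?_
  have h2 := h.ae_eval_eq_zero (f := X * ((C x - X) * (q * q)))
    (by rw [natDegree_weight_mul hq]; omega) (fun t ht => eval_weight_mul_nonneg q hx.le ht)
    (momentFunctional_weight_eq_zero ho (by omega))
  filter_upwards [h2, h.ae_mem] with t ht htm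
  have : x - t ≠ 0 := by linarith [htm.2]
  simp only [eval_mul, eval_sub, eval_C, eval_X, mul_eq_zero] at ht ⊢
  tauto

theorem exists_radau_zero (hm : 1 ≤ m) (hL : PosOn (momentFunctional b) (m + 1))
    (hS : PosOn (momentFunctional (shift b)) m) {S : Finset ℝ} (hc : S.card = m)
    (ho : OrthTo (momentFunctional (shift b)) (Lagrange.nodal S id) m) :
    0 ∉ S ∧ (∀ t ∈ S, 0 < t) ∧ ∃ w : ℝ → ℝ, (∀ t ∈ insert 0 S, 0 < w t) ∧
      ∀ f : ℝ[X], f.natDegree ≤ 2 * m →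
        momentFunctional b f = ∑ t ∈ insert 0 S, w t * f.eval t := by
  have hM : momentFunctional (shift b) =
      momentFunctional b ∘ₗ LinearMap.mulLeft ℝ (C 1 * (X - C 0)) := by
    refine LinearMap.ext fun p => ?_
    simp [momentFunctional_shift]
  rw [hM] at hS ho
  simpa using exists_radau hm one_ne_zero hL hc hS ho

theorem exists_radau_right (hm : 1 ≤ m) (hL : PosOn (momentFunctional b) (m + 1))
    (hS : PosOn (momentFunctional fun i => Λ * b i - b (i + 1)) m) {S : Finset ℝ}
    (hc : S.card = m)
    (ho : OrthTo (momentFunctional fun i => Λ * b i - b (i + 1)) (Lagrange.nodal S id) m) :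
    Λ ∉ S ∧ (∀ t ∈ S, t < Λ) ∧ ∃ w : ℝ → ℝ, (∀ t ∈ insert Λ S, 0 < w t) ∧
      ∀ f : ℝ[X], f.natDegree ≤ 2 * m →
        momentFunctional b f = ∑ t ∈ insert Λ S, w t * f.eval t := by
  have hM : (momentFunctional fun i => Λ * b i - b (i + 1)) =
      momentFunctional b ∘ₗ LinearMap.mulLeft ℝ (C (-1) * (X - C Λ)) := by
    refine LinearMap.ext fun p => ?_
    simp [momentFunctional_sub_shift]
  rw [hM] at hS ho
  simpa using exists_radau hm (neg_ne_zero.2 one_ne_zero) hL hc hS ho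

/-- If the roots of the shifted orthogonal polynomial do not exceed `Λ`, the problem is solved by
the Radau quadrature with prescribed node `0`. -/
theorem exists_isSolution_of_eval_nonneg (hm : 1 ≤ m) (hΛ : 0 < Λ)
    (hL : PosOn (momentFunctional b) (m + 1)) (hS : PosOn (momentFunctional (shift b)) m)
    (hQ : Q.Monic) (hQd : Q.natDegree = m) (ho : OrthTo (momentFunctional (shift b)) Q m)
    (h0 : ∀ x, Λ ≤ x → 0 ≤ Q.eval x) : ∃ μ, IsSolution b m Λ μ := by
  obtain ⟨S, rfl, hc⟩ := OrthTo.exists_nodal hS hQ hQd ho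
  obtain ⟨-, hpos, w, hw, hquad⟩ := exists_radau_zero hm hL hS hc ho
  refine ⟨_, isSolution_sum_dirac (fun t ht => ?_) (fun t ht => (hw t ht).le) hquad⟩
  rcases Finset.mem_insert.1 ht with rfl | htS
  · exact ⟨le_rfl, hΛ.le⟩
  refine ⟨(hpos t htS).le, ?_⟩
  by_contra! hlt
  -- A root beyond `Λ` would be a local minimum of the nodal polynomial, but its roots are simple.
  have hmin : IsLocalMin (fun x => (Lagrange.nodal S id).eval x) t := by
    filter_upwards [lt_mem_nhds hlt] with x hx
    rw [eval_nodal_eq_zero htS]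
    exact h0 x hx.le
  have h1 := hmin.deriv_eq_zero
  rw [Polynomial.deriv] at h1
  have h2 := Lagrange.eval_nodal_derivative_eval_node_eq (v := (id : ℝ → ℝ)) htS
  simp only [id] at h2
  exact eval_nodal_ne_zero (Finset.notMem_erase t S) (h2.symm.trans h1)

/-- A non-zero polynomial cannot vanish at more points than its degree. -/
theorem sum_mul_eval_sq_pos {S : Finset ℝ} {u : ℝ → ℝ} (hu : ∀ t ∈ S, 0 < u t) {q : ℝ[X]}
    (hq : q ≠ 0) (hd : q.natDegree < S.card) : 0 < ∑ t ∈ S, u t * (q.eval t * q.eval t) := by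
  have h0 : ∀ t ∈ S, 0 ≤ u t * (q.eval t * q.eval t) := fun t ht =>
    mul_nonneg (hu t ht).le (mul_self_nonneg _)
  refine (Finset.sum_nonneg h0).lt_of_ne' fun hz => hq ?_
  rw [Finset.sum_eq_zero_iff_of_nonneg h0] at hz
  refine eq_zero_of_degree_lt_of_eval_finset_eq_zero S
    (degree_le_natDegree.trans_lt (by exact_mod_cast hd)) fun t ht => ?_
  simpa [(hu t ht).ne'] using hz t ht

/-- If the roots of the shifted orthogonal polynomial are less than `Λ`, the Radau quadratures
with prescribed nodes `0` and `Λ` are two different solutions. -/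
theorem exists_isSolution_ne (hm : 1 ≤ m) (hΛ : 0 < Λ)
    (hL : PosOn (momentFunctional b) (m + 1)) (hS : PosOn (momentFunctional (shift b)) m)
    (hQ : Q.Monic) (hQd : Q.natDegree = m) (ho : OrthTo (momentFunctional (shift b)) Q m)
    (h0 : ∀ x, Λ ≤ x → Q.eval x ≠ 0) :
    ∃ μ ν, IsSolution b m Λ μ ∧ IsSolution b m Λ ν ∧ μ ≠ ν := by
  obtain ⟨S, rfl, hc⟩ := OrthTo.exists_nodal hS hQ hQd ho
  obtain ⟨h0S, hpos, w, hw, hquad⟩ := exists_radau_zero hm hL hS hc ho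
  have hlt : ∀ t ∈ S, t < Λ := fun t ht => by
    by_contra! h
    exact h0 t h (eval_nodal_eq_zero ht)
  have hlt' : ∀ t ∈ insert 0 S, t < Λ := fun t ht => by
    rcases Finset.mem_insert.1 ht with rfl | htS
    exacts [hΛ, hlt t htS]
  have hR : PosOn (momentFunctional fun i => Λ * b i - b (i + 1)) m := by
    intro q hq hqd
    rw [momentFunctional_sub_shift, hquad _ (by
      rw [natDegree_mul (C_sub_X_ne_zero Λ) (mul_ne_zero hq hq), natDegree_mul hq hq,
        natDegree_C_sub_X]
      omega)]
    have := sum_mul_eval_sq_pos (u := fun t => w t * (Λ - t)) (S := insert 0 S)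
      (fun t ht => mul_pos (hw t ht) (sub_pos.2 (hlt' t ht))) hq
      (by rw [Finset.card_insert_of_notMem h0S]; omega)
    simpa [mul_assoc] using this
  -- The weight `t (Λ - t)` kills the node `0`; the remaining `m` nodes still detect degree below
  -- `m`.
  have hR' : ∀ q : ℝ[X], q ≠ 0 → q.natDegree < m →
      0 < momentFunctional b (X * ((C Λ - X) * (q * q))) := by
    intro q hq hqd
    rw [hquad _ (by rw [natDegree_weight_mul hq]; omega), Finset.sum_insert h0S]
    have := sum_mul_eval_sq_pos (u := fun t => w t * (t * (Λ - t))) (S := S)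
      (fun t ht => mul_pos (hw t (Finset.mem_insert_of_mem ht))
        (mul_pos (hpos t ht) (sub_pos.2 (hlt t ht)))) hq (by omega)
    simpa [mul_assoc] using this
  obtain ⟨T, hT, hTd, hTo⟩ := exists_monic_orthTo hR
  obtain ⟨S', rfl, hc'⟩ := OrthTo.exists_nodal hR hT hTd hTo
  obtain ⟨-, hlt2, w', hw', hquad'⟩ := exists_radau_right hm hL hR hc' hTo
  have hpos2 : ∀ t ∈ insert Λ S', 0 < t := by
    intro t ht
    rcases Finset.mem_insert.1 ht with rfl | htS
    · exact hΛ
    set q := Lagrange.nodal (S'.erase t) (id : ℝ → ℝ) with hq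
    have hq0 : q ≠ 0 := Lagrange.nodal_ne_zero
    have hqd := natDegree_nodal_erase htS
    rw [← hq] at hqd
    have h1 := hR q hq0 (by omega)
    have h2 := hR' q hq0 (by omega)
    have h3 := hTo q (by omega)
    rw [momentFunctional_sub_shift] at h1 h3
    rw [nodal_eq_sub_mul_erase htS, ← hq] at h3
    -- Orthogonality of the nodal polynomial turns the factor `X` into the number `t`, so the two
    -- positive values force `t > 0`.
    rw [show X * ((C Λ - X) * (q * q)) =
      (C Λ - X) * ((X - C t) * q * q) + C t * ((C Λ - X) * (q * q)) by ring, map_add, h3,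
      zero_add, momentFunctional_C_mul] at h2
    exact pos_of_mul_pos_left h2 h1.le
  refine ⟨_, _, isSolution_sum_dirac (fun t ht => ⟨?_, (hlt' t ht).le⟩)
    (fun t ht => (hw t ht).le) hquad,
    isSolution_sum_dirac (fun t ht => ⟨(hpos2 t ht).le, ?_⟩) (fun t ht => (hw' t ht).le) hquad',
    fun heq => ?_⟩
  · rcases Finset.mem_insert.1 ht with rfl | htS
    exacts [le_rfl, (hpos t htS).le]
  · rcases Finset.mem_insert.1 ht with rfl | htS
    exacts [le_rfl, (hlt2 t htS).le]
  -- The first solution has mass `w 0 > 0` at `0`, while all nodes of the second are positive.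
  · have h1 := congrArg (fun μ : Measure ℝ => μ {0}) heq
    simp only [Measure.finsetSum_apply, Measure.smul_apply, smul_eq_mul] at h1
    have h2 : ∑ t ∈ insert Λ S', ENNReal.ofReal (w' t) * Measure.dirac t {0} = 0 := by
      refine Finset.sum_eq_zero fun t ht => ?_
      rw [Measure.dirac_apply' _ (measurableSet_singleton _)]
      simp [(hpos2 t ht).ne']
    rw [h2, Finset.sum_eq_zero_iff] at h1
    have h3 := h1 0 (Finset.mem_insert_self _ _)
    simp only [Measure.dirac_apply' _ (measurableSet_singleton (0 : ℝ)), Set.mem_singleton_iff,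
      Set.indicator_of_mem, Pi.one_apply, mul_one, ENNReal.ofReal_eq_zero] at h3
    exact (hw 0 (Finset.mem_insert_self _ _)).not_ge h3

end Definite

theorem smul_hankel_sub_hankel_shift (b : ℕ → ℝ) (Λ : ℝ) (n : ℕ) :
    Λ • hankel b n - hankel (shift b) n = hankel (fun i => Λ * b i - b (i + 1)) n := by
  ext i j
  simp [hankel, shift]

theorem IsSolution.posSemidef_sub {b : ℕ → ℝ} {m : ℕ} (hm : 1 ≤ m) {Λ : ℝ} {μ : Measure ℝ}
    (h : IsSolution b m Λ μ) : (Λ • hankel b m - hankel (shift b) m).PosSemidef := by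
  rw [smul_hankel_sub_hankel_shift, posSemidef_hankel_iff _ hm]
  intro q hq
  rw [momentFunctional_sub_shift]
  refine h.momentFunctional_nonneg ?_ fun t ht => ?_
  · refine natDegree_mul_le.trans ?_
    have := natDegree_mul_le (p := q) (q := q)
    rw [natDegree_C_sub_X]
    omega
  · simp only [eval_mul, eval_sub, eval_C, eval_X]
    exact mul_nonneg (sub_nonneg.2 ht.2) (mul_self_nonneg _)

end

end TruncatedHausdorff

end

/-! ### The theorem. -/

theorem theorem2 (m : ℕ) (hm : 1 ≤ m) (b : ℕ → ℝ) (Λ : ℝ) (hΛ : 0 < Λ)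
    (ha : (TruncatedHausdorff.hankel b (m + 1)).PosSemidef)
    (hb : ∀ r ≤ m - 1, ∀ ξ : ℕ → ℂ, TruncatedHausdorff.hankelForm b r ξ = 0 →
      TruncatedHausdorff.hankelForm (fun i => b (i + 2)) r ξ = 0)
    (hc : (TruncatedHausdorff.hankel (TruncatedHausdorff.shift b) m).PosSemidef ∧
      ∀ r ≤ m - 1, ∀ ξ : ℕ → ℂ,
        TruncatedHausdorff.hankelForm (TruncatedHausdorff.shift b) r ξ = 0 →
        TruncatedHausdorff.hankelForm (fun i => b (i + 2)) r ξ = 0) :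
    ((∃ μ : Measure ℝ, TruncatedHausdorff.IsSolution b m Λ μ) ↔
      (Λ • TruncatedHausdorff.hankel b m -
        TruncatedHausdorff.hankel (TruncatedHausdorff.shift b) m).PosSemidef ∧
      (0 < TruncatedHausdorff.hankelDet b (m + 1) →
        ∀ x : ℝ, Λ ≤ x →
          TruncatedHausdorff.orthPoly b m x ≠ 0 ∧ TruncatedHausdorff.ratio b m x ≤ 1)) ∧
    ((∃ μ : Measure ℝ, TruncatedHausdorff.IsSolution b m Λ μ) →
      ((∃! μ : Measure ℝ, TruncatedHausdorff.IsSolution b m Λ μ) ↔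
        (0 < TruncatedHausdorff.hankelDet b (m + 1) →
          TruncatedHausdorff.ratio b m Λ = 1))) := by
  open TruncatedHausdorff Polynomial in
  have hforms : ∀ (c : ℕ → ℝ) (q : ℝ[X]), (∀ r ≤ m - 1, ∀ ξ : ℕ → ℂ, hankelForm c r ξ = 0 →
      hankelForm (fun i => b (i + 2)) r ξ = 0) → q.natDegree < m →
      momentFunctional c (q * q) = 0 → momentFunctional b (X * q * (X * q)) = 0 := by
    intro c q h hq h0
    have h1 := h (m - 1) le_rfl (fun i => (q.coeff i : ℂ))
    rw [hankelForm_coeff c (by omega), hankelForm_coeff _ (by omega), h0] at h1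
    have h2 : momentFunctional (fun i => b (i + 2)) (q * q) = 0 := by exact_mod_cast h1 rfl
    rw [show (fun i => b (i + 2)) = shift (shift b) from rfl, momentFunctional_shift,
      momentFunctional_shift] at h2
    rw [← h2]
    congr 1
    ring
  open TruncatedHausdorff Polynomial in
  have ha' := (posSemidef_hankel_iff b m.succ_pos).1 ha
  by_cases hd : 0 < TruncatedHausdorff.hankelDet b (m + 1)
  · have hL := TruncatedHausdorff.posOn_of_hankelDet_pos ha hd
    -- By (c) a null `q` of the shifted functional would make `X q` null for `L`, against
    -- definiteness in degree `m`.
    have hS : TruncatedHausdorff.PosOn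
        (TruncatedHausdorff.momentFunctional (TruncatedHausdorff.shift b)) m := by
      intro q hq hqd
      refine ((TruncatedHausdorff.posSemidef_hankel_iff _ hm).1 hc.1 q hqd).lt_of_ne' fun h0 => ?_
      refine (hL _ (mul_ne_zero Polynomial.X_ne_zero hq) ?_).ne' (hforms _ q hc.2 hqd h0)
      rw [Polynomial.natDegree_X_mul hq]
      omega
    obtain ⟨P, Q, ⟨hP, hPd, hPo⟩, ⟨hQ, hQd, hQo⟩, hPQ⟩ :=
      TruncatedHausdorff.exists_orthogonal_pair hm hL hS
    have hPne : ∀ μ, TruncatedHausdorff.IsSolution b m Λ μ → ∀ x, Λ ≤ x → P.eval x ≠ 0 :=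
      fun μ hμ x hx => hμ.eval_orthogonal_ne_zero hL hP hPd hPo hx
    refine ⟨⟨?_, ?_⟩, ?_⟩
    · rintro ⟨μ, hμ⟩
      refine ⟨hμ.posSemidef_sub hm, fun _ x hx => ?_⟩
      have hPx := hPne μ hμ x hx
      refine ⟨(hPQ x).1.2 hPx, ?_⟩
      have h1 : 0 ≤ P.eval x :=
        TruncatedHausdorff.eval_nonneg_of_monic hP (fun y hy => hPne μ hμ y hy.le) hx
      have h2 : 0 ≤ Q.eval x := TruncatedHausdorff.eval_nonneg_of_monic hQ
        (fun y hy => hμ.eval_shifted_orthogonal_ne_zero hL hQ hQd hQo hy) hx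
      rw [(hPQ x).2 hPx]
      linarith [div_nonneg h2 h1]
    · rintro ⟨-, h⟩
      have hPx : ∀ x, Λ ≤ x → P.eval x ≠ 0 := fun x hx => (hPQ x).1.1 (h hd x hx).1
      refine TruncatedHausdorff.exists_isSolution_of_eval_nonneg hm hΛ hL hS hQ hQd hQo
        fun x hx => ?_
      have h1 : 0 ≤ P.eval x :=
        TruncatedHausdorff.eval_nonneg_of_monic hP (fun y hy => hPx y hy.le) hx
      have h2 := (h hd x hx).2
      rw [(hPQ x).2 (hPx x hx)] at h2
      have h3 : 0 ≤ Q.eval x / P.eval x := by linarith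
      have h4 := mul_nonneg h3 h1
      rwa [div_mul_cancel₀ _ (hPx x hx)] at h4
    · rintro ⟨μ, hμ⟩
      have hPΛ := hPne μ hμ Λ le_rfl
      have hratio : TruncatedHausdorff.ratio b m Λ = 1 ↔ Q.eval Λ = 0 := by
        rw [(hPQ Λ).2 hPΛ, sub_eq_self, div_eq_zero_iff, or_iff_left hPΛ]
      rw [hratio]
      constructor
      · intro huniq _
        by_contra hne
        obtain ⟨μ₁, μ₂, h1, h2, h12⟩ :=
          TruncatedHausdorff.exists_isSolution_ne hm hΛ hL hS hQ hQd hQo fun x hx => by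
            rcases hx.eq_or_lt with rfl | hlt
            exacts [hne, hμ.eval_shifted_orthogonal_ne_zero hL hQ hQd hQo hlt]
        exact h12 (huniq.unique h1 h2)
      · intro h
        obtain ⟨q, rfl, hq, hqd⟩ := TruncatedHausdorff.exists_eq_X_sub_C_mul hQ (h hd)
        refine ⟨μ, hμ, fun ν hν => hν.eq_of_null hμ
          (f := Polynomial.X * ((Polynomial.C Λ - Polynomial.X) * (q * q))) ?_ ?_ ?_ ?_⟩
        · exact mul_ne_zero Polynomial.X_ne_zero
            (mul_ne_zero (TruncatedHausdorff.C_sub_X_ne_zero Λ) (mul_ne_zero hq hq))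
        · rw [TruncatedHausdorff.natDegree_weight_mul hq]
          omega
        · exact fun t ht => TruncatedHausdorff.eval_weight_mul_nonneg q le_rfl ht
        · exact TruncatedHausdorff.momentFunctional_weight_eq_zero hQo (by omega)
  · have hnull := TruncatedHausdorff.exists_null_of_hankelDet_not_pos m.succ_pos ha hd
    refine ⟨⟨?_, ?_⟩, ?_⟩
    · rintro ⟨μ, hμ⟩
      exact ⟨hμ.posSemidef_sub hm, fun h => absurd h hd⟩
    · rintro ⟨hpsd, -⟩
      rw [TruncatedHausdorff.smul_hankel_sub_hankel_shift,
        TruncatedHausdorff.posSemidef_hankel_iff _ hm] at hpsd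
      refine TruncatedHausdorff.exists_isSolution_of_null ha' (fun q => hforms b q hb)
        (fun q hq => ?_) (fun q hq => ?_) hnull
      · rw [← TruncatedHausdorff.momentFunctional_shift]
        exact (TruncatedHausdorff.posSemidef_hankel_iff _ hm).1 hc.1 q hq
      · rw [← TruncatedHausdorff.momentFunctional_sub_shift]
        exact hpsd q hq
    · rintro ⟨μ, hμ⟩
      refine ⟨fun _ h => absurd h hd, fun _ => ⟨μ, hμ, fun ν hν => ?_⟩⟩
      obtain ⟨q, hq, hqd, h0⟩ := hnull
      refine hν.eq_of_null hμ (f := q * q) (mul_ne_zero hq hq) ?_ (fun t _ => ?_) h0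
      · rw [Polynomial.natDegree_mul hq hq]
        omega
      · rw [Polynomial.eval_mul]
        exact mul_self_nonneg _
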